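/- Let $T$ be a finite tree of strings over $\Sigma_m=\{0,\dots,m-1\}$, given by its terminal nodes $\tau_0,\dots,\tau_{k-1}$ ($k\ge 1$), which are non-empty strings none of which is an initial segment of another. Let $T^*$ be the set of all initial segments of finite concatenations of terminal nodes, and $F_T=[T^*]$ the set of infinite sequences all of whose initial segments lie in $T^*$. Let $\ell(i)=|\tau_i|$, let $\alpha\ge 0$ be the channel capacity of $\ell$, i.e. the unique $\alpha\geq 0$ with $\sum_{i<k}2^{-\alpha\ell(i)}=1$, and let $\mu_\ell$ be the Bernoulli measure on $\Sigma_k^\infty$ with $\mu_\ell(i)=2^{-\alpha\ell(i)}$. Let $\Psi_T(y)=\tau_{y(0)}{}^\frown\tau_{y(1)}{}^\frown\cdots$ for $y\in\Sigma_k^\infty$. Let $\mathcal G=(G,v_1)$ be the pointed labelled graph of $T$: its vertices are the non-terminal nodes of $T$, $v_1$ is the root, each edge of $T$ between non-terminal nodes is an edge of $G$ with the same label, and each edge of $T$ from $\sigma$ to a terminal node becomes an edge from $\sigma$ to $v_1$ with the same label. Let $A$ be its adjacency matrix and $\rho$ the Perron (largest real) eigenvalue of $A$. The sofic shift $X_G$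 is the set of label sequences of all one-sided infinite walks in $G$, and the path set of $\mathcal G$ is the set of label sequences of those walks that begin at $v_1$. The Parry measure on the infinite walks in $G$ is the Markov measure with initial probabilities $l_vr_v$ and with probability $r_v/(r_u\rho)$ of continuing along a given edge from $u$ to $v$, where $l,r$ are positive left and right eigenvectors of $A$ for $\rho$ with $\sum_v l_vr_v=1$; the Parry measure on $X_G$ is the distribution of the label sequence of a walk drawn from it. By its restriction to the path set of $\mathcal G$ we mean the distribution of the label sequence of such a walk, given that the walk begins at $v_1$. Then the path set of $\mathcal G$ is $F_T$, the map $\Psi_T$ is a bijection from $\Sigma_k^\infty$ onto $F_T$, there is exactly one Parry measure on the infinite walks in $G$, its label distribution is carried by $X_G$, and its restriction to the path set of $\mathcal G$ is carried by this path set and is equal to the pushforward of $\mu_\ell$ under $\Psi_T$. In particular, both assign $\rho^{-|\tau|}$ to the cylinder $\llbracket\tau\rrbracket$ of each terminal node $\tau$ of $T$. -/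

import Mathlib

open MeasureTheory ProbabilityTheory
open scoped Matrix ENNReal

noncomputable section

/-! ### Sequences, length functions and their Bernoulli measures -/

/-- The cylinder set of all infinite sequences over `Fin m` that extend the string `σ`. -/
def seqCylinder {m : ℕ} (σ : List (Fin m)) : Set (ℕ → Fin m) :=
  {x | ∀ (i : ℕ) (h : i < σ.length), x i = σ[i]}

/-- The channel capacity of a length function `ℓ` on `k` symbols: the number `α ≥ 0` with
`∑ i, 2 ^ (-α * ℓ i) = 1`. It exists and is unique when `0 < k` and all lengths are positive, see
`existsUnique_channelCapacity`, so that the supremum is over a one-element set. -/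
def channelCapacity {k : ℕ} (ℓ : Fin k → ℕ) : ℝ :=
  sSup {α : ℝ | 0 ≤ α ∧ ∑ i, (2 : ℝ) ^ (-α * (ℓ i : ℝ)) = 1}

theorem existsUnique_channelCapacity {k : ℕ} (ℓ : Fin k → ℕ) (hk : 0 < k) (hℓ : ∀ i, 0 < ℓ i) :
    ∃! α : ℝ, 0 ≤ α ∧ ∑ i, (2 : ℝ) ^ (-α * (ℓ i : ℝ)) = 1 := by
  have : Nonempty (Fin k) := ⟨⟨0, hk⟩⟩
  have hanti : StrictAnti (fun α : ℝ => ∑ i, (2 : ℝ) ^ (-α * (ℓ i : ℝ))) := by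
    intro a b hab
    refine Finset.sum_lt_sum_of_nonempty Finset.univ_nonempty (fun i _ => ?_)
    refine Real.rpow_lt_rpow_of_exponent_lt (by norm_num) ?_
    have : (0 : ℝ) < ℓ i := by exact_mod_cast hℓ i
    nlinarith
  have hcont : Continuous (fun α : ℝ => ∑ i, (2 : ℝ) ^ (-α * (ℓ i : ℝ))) := by
    refine continuous_finsetSum _ (fun i _ => ?_)
    exact Continuous.rpow continuous_const (by fun_prop) (fun _ => Or.inl (by norm_num))
  have h0 : (1 : ℝ) ≤ ∑ i, (2 : ℝ) ^ (-(0 : ℝ) * (ℓ i : ℝ)) := by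
    have : (1 : ℝ) ≤ k := by exact_mod_cast hk
    simpa using this
  have h1 : ∑ i, (2 : ℝ) ^ (-(k : ℝ) * (ℓ i : ℝ)) ≤ 1 := by
    have hle : ∀ i : Fin k, (2 : ℝ) ^ (-(k : ℝ) * (ℓ i : ℝ)) ≤ 1 / k := by
      intro i
      have hl : (1 : ℝ) ≤ ℓ i := by exact_mod_cast hℓ i
      have hkp : (0 : ℝ) < k := by exact_mod_cast hk
      have hk2 : (k : ℝ) ≤ 2 ^ k := by exact_mod_cast (Nat.lt_two_pow_self (n := k)).le
      calc (2 : ℝ) ^ (-(k : ℝ) * (ℓ i : ℝ)) ≤ (2 : ℝ) ^ (-(k : ℝ)) :=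
            Real.rpow_le_rpow_of_exponent_le (by norm_num) (by nlinarith)
        _ = 1 / 2 ^ k := by rw [Real.rpow_neg (by norm_num), Real.rpow_natCast, one_div]
        _ ≤ 1 / k := one_div_le_one_div_of_le hkp hk2
    calc ∑ i, (2 : ℝ) ^ (-(k : ℝ) * (ℓ i : ℝ)) ≤ ∑ _i : Fin k, (1 / k : ℝ) :=
          Finset.sum_le_sum (fun i _ => hle i)
      _ = 1 := by
        have : (k : ℝ) ≠ 0 := by exact_mod_cast hk.ne'
        simp [this]
  obtain ⟨α, hα, hα1⟩ := intermediate_value_Icc' (Nat.cast_nonneg k) hcont.continuousOn ⟨h1, h0⟩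
  exact ⟨α, ⟨hα.1, hα1⟩, fun β hβ => hanti.injective (hβ.2.trans hα1.symm)⟩

theorem channelCapacity_spec {k : ℕ} (ℓ : Fin k → ℕ) (hk : 0 < k) (hℓ : ∀ i, 0 < ℓ i) :
    0 ≤ channelCapacity ℓ ∧ ∑ i, (2 : ℝ) ^ (-channelCapacity ℓ * (ℓ i : ℝ)) = 1 := by
  obtain ⟨α, hα, hu⟩ := existsUnique_channelCapacity ℓ hk hℓ
  have hset : {α : ℝ | 0 ≤ α ∧ ∑ i, (2 : ℝ) ^ (-α * (ℓ i : ℝ)) = 1} = {α} := by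
    ext β
    exact ⟨fun h => hu β h, fun h => by rw [Set.mem_singleton_iff] at h; subst h; exact hα⟩
  have : channelCapacity ℓ = α := by rw [channelCapacity, hset, csSup_singleton]
  rw [this]
  exact hα

/-- The distribution of one symbol under the measure derived from `ℓ`:
the symbol `i` has weight `2 ^ (-α * ℓ i)`, where `α` is the channel capacity. -/
def symbolMeasure {k : ℕ} (ℓ : Fin k → ℕ) : Measure (Fin k) :=
  ∑ i, ENNReal.ofReal ((2 : ℝ) ^ (-channelCapacity ℓ * (ℓ i : ℝ))) • Measure.dirac i

theorem isProbabilityMeasure_symbolMeasure {k : ℕ} (ℓ : Fin k → ℕ) (hk : 0 < k)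
    (hℓ : ∀ i, 0 < ℓ i) : IsProbabilityMeasure (symbolMeasure ℓ) := by
  constructor
  have h := (channelCapacity_spec ℓ hk hℓ).2
  simp only [symbolMeasure, Measure.coe_finsetSum, Finset.sum_apply, Measure.smul_apply,
    measure_univ, smul_eq_mul, mul_one]
  rw [← ENNReal.ofReal_sum_of_nonneg (fun i _ => Real.rpow_nonneg (by norm_num) _), h,
    ENNReal.ofReal_one]

/-! ### Pointed labelled graphs, path sets and Parry measures -/

/-- A directed graph on `V` with edges labelled by `Fin m` and a distinguished vertex. Multiple
edges and loops are allowed; edges between the same two vertices have different labels, so that an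
edge is given by its source, its label and its target. -/
structure PointedGraph (m : ℕ) (V : Type) where
  edges : Set (V × Fin m × V)
  pt : V

namespace PointedGraph

variable {m : ℕ} {V : Type} (G : PointedGraph m V)

/-- The type of edges. -/
def Edge : Type := {e : V × Fin m × V // e ∈ G.edges}

variable {G} in
/-- The initial vertex of an edge. -/
def Edge.src (e : G.Edge) : V := e.1.1

variable {G} in
/-- The label of an edge. -/
def Edge.label (e : G.Edge) : Fin m := e.1.2.1

variable {G} in
/-- The terminal vertex of an edge. -/
def Edge.tgt (e : G.Edge) : V := e.1.2.2

instance : MeasurableSpace G.Edge := ⊤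

/-- One-sided infinite walks, starting at any vertex. -/
def Walk : Type := {w : ℕ → G.Edge // ∀ n, (w n).tgt = (w (n + 1)).src}

instance : MeasurableSpace G.Walk :=
  inferInstanceAs (MeasurableSpace {w : ℕ → G.Edge // ∀ n, (w n).tgt = (w (n + 1)).src})

variable {G} in
/-- The sequence of edge labels along a walk. -/
def Walk.labels (w : G.Walk) : ℕ → Fin m := fun n => (w.1 n).label

/-- The walks that begin at the distinguished vertex. -/
def pointedWalks : Set G.Walk := {w | (w.1 0).src = G.pt}

/-- The sofic shift presented by `G`: the label sequences of all infinite walks. -/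
def soficShift : Set (ℕ → Fin m) := Set.range (Walk.labels (G := G))

/-- The path set of `G`: the label sequences of the infinite walks that begin at the distinguished
vertex. -/
def pathSet : Set (ℕ → Fin m) := Walk.labels '' G.pointedWalks

/-- The adjacency matrix, counting the edges from `u` to `v`. -/
def adjMatrix : Matrix V V ℝ :=
  Matrix.of fun u v => (Nat.card {a : Fin m // (u, a, v) ∈ G.edges} : ℝ)

variable [Fintype V]

/-- The Perron eigenvalue: the largest real eigenvalue of the adjacency matrix. -/
def perronEigenvalue : ℝ :=
  sSup {x : ℝ | Module.End.HasEigenvalue G.adjMatrix.mulVecLin x}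

/-- `P` is the Parry measure on the infinite walks through `G`: the Markov measure in which, with
`l` and `r` the positive left and right eigenvectors for the Perron eigenvalue `ρ`, normalized by
`∑ v, l v * r v = 1`, the initial vertex is `v` with probability `l v * r v` and a walk which is at
`u` continues along an edge from `u` to `v` with probability `r v / (r u * ρ)`. -/
def IsParryMeasure (P : Measure G.Walk) : Prop :=
  IsProbabilityMeasure P ∧
  ∃ l r : V → ℝ, (∀ v, 0 < l v) ∧ (∀ v, 0 < r v) ∧
    l ᵥ* G.adjMatrix = G.perronEigenvalue • l ∧
    G.adjMatrix *ᵥ r = G.perronEigenvalue • r ∧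
    ∑ v, l v * r v = 1 ∧
    ∀ (w : G.Walk) (n : ℕ),
      P {w' | ∀ i ≤ n, w'.1 i = w.1 i} =
        ENNReal.ofReal (l (w.1 0).src * r (w.1 0).src *
          ∏ i ∈ Finset.range (n + 1),
            r (w.1 i).tgt / (r (w.1 i).src * G.perronEigenvalue))

end PointedGraph

/-- The Parry measure `P` on the sofic shift presented by `G` (carried by the infinite walks
through `G`), restricted to the path set of `G`: the law of the label sequence of a `P`-random
walk, given that the walk begins at the distinguished vertex. -/
def PointedGraph.restrictToPathSet {m : ℕ} {V : Type} (G : PointedGraph m V)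
    (P : Measure G.Walk) : Measure (ℕ → Fin m) :=
  (P[|G.pointedWalks]).map PointedGraph.Walk.labels

/-! ### Finite trees -/

/-- A finite tree of strings over `Fin m`, given by an enumeration `node` of its `k ≥ 1` terminal
nodes, which are pairwise incomparable and different from the root. -/
structure FiniteTree (m k : ℕ) where
  node : Fin k → List (Fin m)
  prefix_free : ∀ i j, node i <+: node j → i = j
  node_ne_nil : ∀ i, node i ≠ []
  pos : 0 < k

namespace FiniteTree

variable {m k : ℕ} (T : FiniteTree m k)

/-- The length function induced by the tree. -/
def len (i : Fin k) : ℕ := (T.node i).length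

theorem len_pos (i : Fin k) : 0 < T.len i := List.length_pos_iff.2 (T.node_ne_nil i)

/-- The tree itself: all initial segments of terminal nodes. -/
def nodes : Set (List (Fin m)) := {σ | ∃ i, σ <+: T.node i}

/-- The nodes of the infinite tree that is obtained by attaching a copy of the tree at each terminal
node, recursively: the initial segments of finite concatenations of terminal nodes. -/
def star : Set (List (Fin m)) := {σ | ∃ L : List (Fin k), σ <+: L.flatMap T.node}

/-- The self-similar fractal generated by the tree: the infinite paths through `T.star`. -/
def fractal : Set (ℕ → Fin m) := {x | ∀ n : ℕ, List.ofFn (fun i : Fin n => x i) ∈ T.star}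

/-- The non-terminal nodes. -/
def Vertex : Type := {σ : List (Fin m) // σ ∈ T.nodes ∧ ∀ i, σ ≠ T.node i}

instance : Finite T.Vertex := by
  have h : T.nodes.Finite := by
    have : T.nodes ⊆ ⋃ i, {σ | σ ∈ (T.node i).inits} := by
      rintro σ ⟨i, hi⟩
      exact Set.mem_iUnion.2 ⟨i, (List.mem_inits _ _).2 hi⟩
    exact (Set.finite_iUnion fun i => List.finite_toSet _).subset this
  exact (h.subset (fun _ hσ => hσ.1 :
    {σ | σ ∈ T.nodes ∧ ∀ i, σ ≠ T.node i} ⊆ T.nodes)).to_subtype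

instance : Fintype T.Vertex := Fintype.ofFinite _

/-- The root, as a non-terminal node. -/
def root : T.Vertex :=
  ⟨[], ⟨⟨0, T.pos⟩, List.nil_prefix⟩, fun i h => T.node_ne_nil i h.symm⟩

/-- The pointed graph of the tree. Its vertices are the non-terminal nodes, the distinguished one
being the root. Each edge of the tree between non-terminal nodes is kept, and each edge of the tree
that leads to a terminal node is redirected to the root, all with their labels. -/
def graph : PointedGraph m T.Vertex where
  edges := {e | e.1.1 ++ [e.2.1] = e.2.2.1 ∨
    (e.2.2 = T.root ∧ ∃ i, e.1.1 ++ [e.2.1] = T.node i)}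
  pt := T.root

instance : IsProbabilityMeasure (symbolMeasure T.len) :=
  isProbabilityMeasure_symbolMeasure T.len T.pos T.len_pos

/-- The Bernoulli measure on sequences over `Fin k` derived from the length function of the tree. -/
def bernoulli : Measure (ℕ → Fin k) := Measure.infinitePi fun _ => symbolMeasure T.len

theorem lt_length_concat (y : ℕ → Fin k) (n : ℕ) :
    n ≤ ((List.range n).flatMap fun i => T.node (y i)).length := by
  induction n with
  | zero => simp
  | succ n ih =>
    have := T.len_pos (y n)
    rw [List.range_succ, List.flatMap_append, List.length_append]
    simp only [List.flatMap_singleton]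
    unfold len at this
    omega

/-- The map taking a coding sequence `y` to the infinite concatenation
`T.node (y 0) ++ T.node (y 1) ++ ⋯`. -/
def decode (y : ℕ → Fin k) : ℕ → Fin m := fun n =>
  ((List.range (n + 1)).flatMap fun i => T.node (y i))[n]'(T.lt_length_concat y (n + 1))

end FiniteTree

end

/-!
The graph of the tree is deterministic, and reading a sequence from the root amounts to parsing it
into terminal nodes: what has been read along a walk is a concatenation of terminal nodes followed
by the current vertex (`exists_src_append_labels`). Hence the label sequences of the walks from
the root are the elements of the fractal (`pathSet_graph`). Since the terminal nodes are
prefix-free, the parsing is unique, and decoding is a bijection (`bijOn_decode`).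

Let `g = 2 ^ α` be the growth rate. The vector `u ↦ g ^ (-|u|)` is a left eigenvector of the
adjacency matrix for `g`, because a vertex other than the root has exactly one incoming edge, and
because `∑ i, g ^ (-ℓ i) = 1` at the root. The vector that sums `g ^ (|u| - ℓ i)` over the
terminal nodes above `u` is a right eigenvector (`adjMatrix_mulVec_weight`). Both are positive, so
that `g` is the Perron eigenvalue (`perronEigenvalue_graph`). Both are unique up to scaling, by
induction on the length of the vertex, upwards from the root and downwards from the terminal
nodes. So all Parry measures agree on the cylinders of walks and therefore coincide (`eq_parry`).

For existence no general construction of Markov measures is needed, since the Parry measure is a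
tower over the Bernoulli measure (`parry`). A code `y` yields a walk from the root, labelled by
the decoded sequence. For each vertex `u` take the codes whose first terminal node lies above `u`,
and remove the first `|u|` edges of their walks. The sum over `u` of the resulting measures,
normalized, has the required values on cylinders (`parry_walkCylinder`): the Bernoulli measure of
the codes whose decoded sequence starts with a concatenation `s` of terminal nodes, followed by a
vertex `v`, is `g ^ (-|s|)` times the product of the two eigenvectors at `v`
(`bernoulli_decode_mem_seqCylinder`). The walks from the root form the level `u = root` of the
tower, and so the conditional law of their labels is the law of the decoded sequence
(`restrictToPathSet_parry`).
-/

/-! ### Cylinders and prefixes -/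

theorem mem_seqCylinder_append {m : ℕ} {s t : List (Fin m)} {x : ℕ → Fin m} :
    x ∈ seqCylinder (s ++ t) ↔
      x ∈ seqCylinder s ∧ (fun n => x (s.length + n)) ∈ seqCylinder t := by
  simp only [seqCylinder, Set.mem_ofPred_eq]
  constructor
  · intro h
    refine ⟨fun i hi => ?_, fun i hi => ?_⟩
    · rw [h i (by simp; omega), List.getElem_append_left hi]
    · rw [h (s.length + i) (by simp; omega), List.getElem_append_right (by omega)]
      simp
  · rintro ⟨h₁, h₂⟩ i hi
    by_cases his : i < s.length
    · rw [h₁ i his, List.getElem_append_left his]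
    · have h := h₂ (i - s.length) (by simp at hi; omega)
      rw [List.getElem_append_right (by omega), ← h]
      congr 1
      omega

theorem seqCylinder_anti {m : ℕ} {s t : List (Fin m)} (h : s <+: t) :
    seqCylinder t ⊆ seqCylinder s := by
  obtain ⟨r, rfl⟩ := h
  exact fun x hx => (mem_seqCylinder_append.1 hx).1

theorem mem_seqCylinder_cons {m : ℕ} {a : Fin m} {s : List (Fin m)} {x : ℕ → Fin m} :
    x ∈ seqCylinder (a :: s) ↔ x 0 = a ∧ (fun n => x (n + 1)) ∈ seqCylinder s := by
  rw [← List.singleton_append, mem_seqCylinder_append]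
  simp [seqCylinder, add_comm]

theorem mem_seqCylinder_ofFn {m : ℕ} (x : ℕ → Fin m) (n : ℕ) :
    x ∈ seqCylinder (List.ofFn fun i : Fin n => x i) := by
  intro i hi
  simp

theorem prefix_of_mem_seqCylinder {m : ℕ} {s t : List (Fin m)} {x : ℕ → Fin m}
    (hs : x ∈ seqCylinder s) (ht : x ∈ seqCylinder t) (h : s.length ≤ t.length) : s <+: t := by
  rw [List.prefix_iff_eq_take]
  refine List.ext_getElem (by simp [h]) fun i h₁ h₂ => ?_
  rw [List.getElem_take, ← hs i h₁, ← ht i (by omega)]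

theorem prefix_total_of_mem_seqCylinder {m : ℕ} {s t : List (Fin m)} {x : ℕ → Fin m}
    (hs : x ∈ seqCylinder s) (ht : x ∈ seqCylinder t) : s <+: t ∨ t <+: s :=
  (le_total s.length t.length).imp (prefix_of_mem_seqCylinder hs ht)
    (prefix_of_mem_seqCylinder ht hs)

theorem ofFn_eq_of_mem_seqCylinder {m : ℕ} {s : List (Fin m)} {x : ℕ → Fin m}
    (hs : x ∈ seqCylinder s) : (List.ofFn fun i : Fin s.length => x i) = s := by
  refine List.ext_getElem (by simp) fun i h₁ h₂ => ?_
  simpa using hs i h₂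

theorem ofFn_succ_last {m : ℕ} (x : ℕ → Fin m) (n : ℕ) :
    (List.ofFn fun i : Fin (n + 1) => x i) = (List.ofFn fun i : Fin n => x i) ++ [x n] := by
  rw [List.ofFn_succ_last]
  simp

namespace FiniteTree

variable {m k : ℕ} (T : FiniteTree m k)

/-! ### Nodes of the tree and of its self-similar extension -/

theorem node_injective : Function.Injective T.node := fun i j h =>
  T.prefix_free i j (h ▸ List.prefix_rfl)

theorem eq_of_prefix_total {i j : Fin k} (h : T.node i <+: T.node j ∨ T.node j <+: T.node i) :
    i = j :=
  h.elim (T.prefix_free i j) fun h => (T.prefix_free j i h).symm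

variable {T} in
theorem mem_nodes_of_prefix {s t : List (Fin m)} (ht : t ∈ T.nodes) (h : s <+: t) :
    s ∈ T.nodes := by
  obtain ⟨i, hi⟩ := ht
  exact ⟨i, h.trans hi⟩

theorem node_mem_nodes (i : Fin k) : T.node i ∈ T.nodes := ⟨i, List.prefix_rfl⟩

variable {T} in
theorem not_node_prefix_vertex (u : T.Vertex) (i : Fin k) : ¬ T.node i <+: u.1 := by
  intro h
  obtain ⟨j, hj⟩ := u.2.1
  obtain rfl := T.prefix_free i j (h.trans hj)
  exact u.2.2 i (List.IsPrefix.eq_of_length_le hj h.length_le)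

variable {T} in
/-- A vertex that is comparable with a terminal node is an initial segment of it. -/
theorem vertex_prefix_node {u : T.Vertex} {i : Fin k} (h : u.1 <+: T.node i ∨ T.node i <+: u.1) :
    u.1 <+: T.node i :=
  h.resolve_right (not_node_prefix_vertex u i)

variable {T} in
/-- Every initial segment of a vertex is a vertex. -/
theorem isVertex_of_prefix {s : List (Fin m)} (u : T.Vertex) (h : s <+: u.1) :
    s ∈ T.nodes ∧ ∀ i, s ≠ T.node i :=
  ⟨mem_nodes_of_prefix u.2.1 h, fun i hi => not_node_prefix_vertex u i (hi ▸ h)⟩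

variable {T} in
theorem exists_parent {t : List (Fin m)} (ht : t ∈ T.nodes) (h0 : t ≠ []) :
    ∃ (p : T.Vertex) (b : Fin m), p.1 ++ [b] = t := by
  refine ⟨⟨t.dropLast, mem_nodes_of_prefix ht (List.dropLast_prefix t), fun i hi => ?_⟩,
    t.getLast h0, List.dropLast_append_getLast h0⟩
  obtain ⟨j, hj⟩ := ht
  obtain rfl := T.prefix_free i j (hi ▸ (List.dropLast_prefix t).trans hj)
  have h₁ := hj.length_le
  have h₂ := congrArg List.length hi
  have h₃ := List.length_pos_iff.2 h0
  rw [List.length_dropLast] at h₂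
  omega

variable {T} in
/-- Terminal nodes at the beginning of a string in `T.star` can be cancelled, since the terminal
nodes are prefix-free. -/
theorem mem_star_of_append_flatMap {L : List (Fin k)} {s : List (Fin m)}
    (h : L.flatMap T.node ++ s ∈ T.star) : s ∈ T.star := by
  induction L with
  | nil => simpa using h
  | cons i L ih =>
    apply ih
    obtain ⟨M, hM⟩ := h
    rw [List.flatMap_cons, List.append_assoc] at hM
    cases M with
    | nil =>
      have := T.node_ne_nil i
      simp_all
    | cons j M =>
      rw [List.flatMap_cons] at hM
      have : i = j := T.eq_of_prefix_total
        (List.prefix_or_prefix_of_prefix ((List.prefix_append _ _).trans hM)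
          (List.prefix_append _ _))
      subst this
      exact ⟨M, (List.prefix_append_right_inj _).1 hM⟩

variable {T} in
/-- In `T.star` a vertex can be extended only inside the tree, so that the walk continues. -/
theorem child_mem_nodes {u : T.Vertex} {a : Fin m} (h : u.1 ++ [a] ∈ T.star) :
    u.1 ++ [a] ∈ T.nodes := by
  obtain ⟨M, hM⟩ := h
  cases M with
  | nil => simp at hM
  | cons j M =>
    rw [List.flatMap_cons] at hM
    rcases List.prefix_or_prefix_of_prefix hM (List.prefix_append _ _) with h | h
    · exact ⟨j, h⟩
    · rcases List.prefix_concat_iff.1 h with h | h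
      · exact ⟨j, by rw [h]⟩
      · exact absurd h (not_node_prefix_vertex u j)

/-! ### Walks in the graph of the tree -/

open Classical in
/-- The vertex reached from `u` by reading the symbol `a`: the child of `u` if that child is a
non-terminal node, and the root otherwise. -/
noncomputable def step (u : T.Vertex) (a : Fin m) : T.Vertex :=
  if h : u.1 ++ [a] ∈ T.nodes ∧ ∀ i, u.1 ++ [a] ≠ T.node i then ⟨u.1 ++ [a], h⟩ else T.root

variable {T} in
theorem step_val {u : T.Vertex} {a : Fin m}
    (h : u.1 ++ [a] ∈ T.nodes ∧ ∀ i, u.1 ++ [a] ≠ T.node i) : (T.step u a).1 = u.1 ++ [a] :=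
  congrArg Subtype.val (dif_pos h)

variable {T} in
theorem step_eq_root {u : T.Vertex} {a : Fin m} {i : Fin k} (h : u.1 ++ [a] = T.node i) :
    T.step u a = T.root :=
  dif_neg fun h' => h'.2 i h

/-- The graph of the tree is deterministic: a vertex has at most one outgoing edge with a given
label. -/
theorem mem_graph_edges {u v : T.Vertex} {a : Fin m} :
    (u, a, v) ∈ T.graph.edges ↔ u.1 ++ [a] ∈ T.nodes ∧ v = T.step u a := by
  simp only [graph, Set.mem_ofPred_eq]
  constructor
  · rintro (h | ⟨rfl, i, h⟩)
    · refine ⟨h ▸ v.2.1, ?_⟩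
      exact Subtype.ext ((step_val (h ▸ v.2)).trans h).symm
    · refine ⟨h ▸ T.node_mem_nodes i, ?_⟩
      exact (step_eq_root h).symm
  · rintro ⟨h, rfl⟩
    by_cases h' : ∀ i, u.1 ++ [a] ≠ T.node i
    · left
      exact (step_val ⟨h, h'⟩).symm
    · right
      push Not at h'
      obtain ⟨i, hi⟩ := h'
      exact ⟨step_eq_root hi, i, hi⟩

theorem edge_src_label_mem_nodes (e : T.graph.Edge) : e.src.1 ++ [e.label] ∈ T.nodes :=
  (T.mem_graph_edges.1 e.2).1

theorem edge_tgt (e : T.graph.Edge) : e.tgt = T.step e.src e.label :=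
  (T.mem_graph_edges.1 e.2).2

theorem edge_ext {e e' : T.graph.Edge} (h₁ : e.src = e'.src) (h₂ : e.label = e'.label) :
    e = e' := by
  have h₃ : e.tgt = e'.tgt := by rw [edge_tgt, edge_tgt, h₁, h₂]
  exact Subtype.ext (Prod.ext h₁ (Prod.ext h₂ h₃))

instance : Finite T.graph.Edge :=
  inferInstanceAs (Finite {e : T.Vertex × Fin m × T.Vertex // e ∈ T.graph.edges})

variable {T} in
theorem exists_append_eq_flatMap_append_step {u : T.Vertex} {a : Fin m}
    (h : u.1 ++ [a] ∈ T.nodes) :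
    ∃ L : List (Fin k), u.1 ++ [a] = L.flatMap T.node ++ (T.step u a).1 := by
  by_cases h' : ∀ i, u.1 ++ [a] ≠ T.node i
  · exact ⟨[], by rw [step_val ⟨h, h'⟩]; simp⟩
  · push Not at h'
    obtain ⟨i, hi⟩ := h'
    exact ⟨[i], by rw [step_eq_root hi, hi]; simp [root]⟩

/-- Reading along a walk, what has been read (after the initial vertex) splits into terminal nodes,
followed by the current vertex. -/
theorem exists_src_append_labels (w : T.graph.Walk) (n : ℕ) :
    ∃ L : List (Fin k), (w.1 0).src.1 ++ (List.ofFn fun i : Fin n => w.labels i) =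
      L.flatMap T.node ++ (w.1 n).src.1 := by
  induction n with
  | zero => exact ⟨[], by simp⟩
  | succ n ih =>
    obtain ⟨L, hL⟩ := ih
    obtain ⟨M, hM⟩ := exists_append_eq_flatMap_append_step (T.edge_src_label_mem_nodes (w.1 n))
    refine ⟨L ++ M, ?_⟩
    rw [ofFn_succ_last, ← List.append_assoc, hL, List.append_assoc, PointedGraph.Walk.labels, hM,
      List.flatMap_append, List.append_assoc, ← w.2 n, edge_tgt]

theorem walk_eq_of_labels_eq {w w' : T.graph.Walk} {n : ℕ} (h0 : (w.1 0).src = (w'.1 0).src)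
    (h : ∀ i ≤ n, w.labels i = w'.labels i) : ∀ i ≤ n, w.1 i = w'.1 i := by
  intro i hi
  induction i with
  | zero => exact T.edge_ext h0 (h 0 hi)
  | succ i ih =>
    refine T.edge_ext ?_ (h _ hi)
    rw [← w.2, ← w'.2, ih (by omega)]

theorem walk_src_eq_of_labels_mem {w : T.graph.Walk} (h0 : (w.1 0).src = T.root) (u : T.Vertex)
    (h : w.labels ∈ seqCylinder u.1) : (w.1 u.1.length).src = u := by
  have key : ∀ n ≤ u.1.length, (w.1 n).src.1 = u.1.take n := by
    intro n hn
    induction n with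
    | zero => simp [h0, root]
    | succ n ih =>
      have hl : (w.1 n).label = u.1[n] := h n hn
      have hc : (w.1 n).src.1 ++ [(w.1 n).label] = u.1.take (n + 1) := by
        rw [ih (by omega), hl, List.take_append_getElem]
      rw [← w.2, edge_tgt, step_val (hc ▸ isVertex_of_prefix u (List.take_prefix _ _)), hc]
  exact Subtype.ext (by rw [key _ le_rfl, List.take_length])

/-- The vertex reached from the root after reading `n` symbols of `x`. -/
noncomputable def state (x : ℕ → Fin m) : ℕ → T.Vertex
  | 0 => T.root
  | n + 1 => T.step (state x n) (x n)

variable {T} in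
theorem state_append_mem_nodes {x : ℕ → Fin m} (hx : x ∈ T.fractal) (n : ℕ) :
    (T.state x n).1 ++ [x n] ∈ T.nodes := by
  have key : ∀ n, (∃ L : List (Fin k), (List.ofFn fun i : Fin n => x i) =
      L.flatMap T.node ++ (T.state x n).1) → (T.state x n).1 ++ [x n] ∈ T.nodes := by
    rintro n ⟨L, hL⟩
    apply child_mem_nodes
    have h := hx (n + 1)
    rw [ofFn_succ_last, hL, List.append_assoc] at h
    exact mem_star_of_append_flatMap h
  refine key n ?_
  induction n with
  | zero => exact ⟨[], by simp [state, root]⟩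
  | succ n ih =>
    obtain ⟨M, hM⟩ := exists_append_eq_flatMap_append_step (key n ih)
    obtain ⟨L, hL⟩ := ih
    refine ⟨L ++ M, ?_⟩
    rw [ofFn_succ_last, hL, List.append_assoc, hM, List.flatMap_append, List.append_assoc, state]

/-- The walk from the root with a given label sequence. -/
noncomputable def walkOf (x : ℕ → Fin m) (hx : x ∈ T.fractal) : T.graph.Walk :=
  ⟨fun n => ⟨(T.state x n, x n, T.state x (n + 1)),
    T.mem_graph_edges.2 ⟨state_append_mem_nodes hx n, rfl⟩⟩, fun _ => rfl⟩

theorem pathSet_graph : T.graph.pathSet = T.fractal := by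
  ext x
  constructor
  · rintro ⟨w, hw, rfl⟩ n
    obtain ⟨L, hL⟩ := T.exists_src_append_labels w n
    have h0 : (w.1 0).src.1 = [] := by
      rw [show (w.1 0).src = T.root from hw]
      rfl
    rw [h0, List.nil_append] at hL
    obtain ⟨i, hi⟩ := (w.1 n).src.2.1
    refine ⟨L ++ [i], ?_⟩
    rw [hL, List.flatMap_append, List.flatMap_singleton]
    exact (List.prefix_append_right_inj _).2 hi
  · intro hx
    exact ⟨T.walkOf x hx, rfl, rfl⟩

/-! ### Decoding -/

theorem flatMap_range_prefix (y : ℕ → Fin k) {n n' : ℕ} (h : n ≤ n') :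
    ((List.range n).flatMap fun i => T.node (y i)) <+:
      (List.range n').flatMap fun i => T.node (y i) := by
  obtain ⟨d, rfl⟩ := Nat.exists_eq_add_of_le h
  rw [List.range_add, List.flatMap_append]
  exact List.prefix_append _ _

theorem decode_mem_seqCylinder (y : ℕ → Fin k) (n : ℕ) :
    T.decode y ∈ seqCylinder ((List.range n).flatMap fun i => T.node (y i)) := by
  intro i hi
  rw [decode]
  rcases le_total (i + 1) n with h | h
  · exact (T.flatMap_range_prefix y h).getElem _
  · exact ((T.flatMap_range_prefix y h).getElem _).symm

variable {T} in
theorem eq_decode {y : ℕ → Fin k} {x : ℕ → Fin m}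
    (h : ∀ n, x ∈ seqCylinder ((List.range n).flatMap fun i => T.node (y i))) :
    x = T.decode y := by
  ext n : 1
  rw [h (n + 1) n (T.lt_length_concat y (n + 1)), decode]

theorem flatMap_range_succ (y : ℕ → Fin k) (n : ℕ) :
    ((List.range (n + 1)).flatMap fun i => T.node (y i)) =
      T.node (y 0) ++ (List.range n).flatMap fun i => T.node (y (i + 1)) := by
  rw [List.range_succ_eq_map, List.flatMap_cons, List.flatMap_map]

theorem decode_tail (y : ℕ → Fin k) :
    (fun n => T.decode y ((T.node (y 0)).length + n)) = T.decode fun n => y (n + 1) := by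
  apply eq_decode
  intro n
  have h := T.decode_mem_seqCylinder y (n + 1)
  rw [flatMap_range_succ] at h
  exact (mem_seqCylinder_append.1 h).2

theorem decode_mem_seqCylinder_head (y : ℕ → Fin k) : T.decode y ∈ seqCylinder (T.node (y 0)) := by
  simpa using T.decode_mem_seqCylinder y 1

variable {T} in
theorem decode_mem_seqCylinder_node_append {y : ℕ → Fin k} {i : Fin k} {s : List (Fin m)} :
    T.decode y ∈ seqCylinder (T.node i ++ s) ↔
      y 0 = i ∧ T.decode (fun n => y (n + 1)) ∈ seqCylinder s := by
  rw [mem_seqCylinder_append]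
  constructor
  · rintro ⟨h₁, h₂⟩
    have h : y 0 = i := T.eq_of_prefix_total
      (prefix_total_of_mem_seqCylinder (T.decode_mem_seqCylinder_head y) h₁)
    subst h
    exact ⟨rfl, T.decode_tail y ▸ h₂⟩
  · rintro ⟨rfl, h⟩
    exact ⟨T.decode_mem_seqCylinder_head y, T.decode_tail y ▸ h⟩

variable {T} in
theorem decode_mem_seqCylinder_vertex {y : ℕ → Fin k} {u : T.Vertex} :
    T.decode y ∈ seqCylinder u.1 ↔ u.1 <+: T.node (y 0) :=
  ⟨fun h => vertex_prefix_node
    (prefix_total_of_mem_seqCylinder h (T.decode_mem_seqCylinder_head y)),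
    fun h => seqCylinder_anti h (T.decode_mem_seqCylinder_head y)⟩

variable {T} in
/-- Prefix-freeness makes parsing unique: the decoded sequence starts with the concatenation coded
by `L`, followed by a vertex `u`, exactly if the code starts with `L`, followed by the index of a
terminal node that extends `u`. -/
theorem decode_mem_seqCylinder_flatMap_append {L : List (Fin k)} {u : T.Vertex} {y : ℕ → Fin k} :
    T.decode y ∈ seqCylinder (L.flatMap T.node ++ u.1) ↔
      ∃ i, u.1 <+: T.node i ∧ y ∈ seqCylinder (L ++ [i]) := by
  induction L generalizing y with
  | nil =>
    simp only [List.flatMap_nil, List.nil_append, decode_mem_seqCylinder_vertex]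
    refine ⟨fun h => ⟨_, h, by simp [seqCylinder]⟩, ?_⟩
    rintro ⟨i, hi, h⟩
    rwa [show y 0 = i from h 0 (by simp)]
  | cons j L ih =>
    rw [List.flatMap_cons, List.append_assoc, decode_mem_seqCylinder_node_append, ih]
    simp only [List.cons_append, mem_seqCylinder_cons]
    grind

theorem decode_injective : Function.Injective T.decode := by
  have h0 : ∀ y y', T.decode y = T.decode y' →
      y 0 = y' 0 ∧ T.decode (fun n => y (n + 1)) = T.decode fun n => y' (n + 1) := by
    intro y y' h
    have h0 : y 0 = y' 0 := T.eq_of_prefix_total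
      (prefix_total_of_mem_seqCylinder (T.decode_mem_seqCylinder_head y)
        (h ▸ T.decode_mem_seqCylinder_head y'))
    refine ⟨h0, ?_⟩
    rw [← decode_tail, ← decode_tail, h, h0]
  intro y y' h
  ext n : 1
  induction n generalizing y y' with
  | zero => exact (h0 y y' h).1
  | succ n ih => exact ih (h0 y y' h).2

theorem decode_mem_fractal (y : ℕ → Fin k) : T.decode y ∈ T.fractal := by
  intro n
  refine ⟨(List.range n).map y, ?_⟩
  rw [List.flatMap_map]
  exact prefix_of_mem_seqCylinder (mem_seqCylinder_ofFn _ n) (T.decode_mem_seqCylinder y n)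
    (by simpa using T.lt_length_concat y n)

variable {T} in
/-- Every sequence in the fractal starts with a terminal node, and removing this node leaves a
sequence in the fractal. -/
theorem exists_node_of_mem_fractal {x : ℕ → Fin m} (hx : x ∈ T.fractal) :
    ∃ i, x ∈ seqCylinder (T.node i) ∧ (fun n => x ((T.node i).length + n)) ∈ T.fractal := by
  -- an initial segment of `x` at least as long as every terminal node
  obtain ⟨L, hL⟩ := hx (∑ i, T.len i)
  have hlen : ∀ i, T.len i ≤ ∑ i, T.len i := fun i =>
    Finset.single_le_sum (f := T.len) (fun _ _ => Nat.zero_le _) (Finset.mem_univ i)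
  cases L with
  | nil =>
    have h₁ := hL.length_le
    have h₂ := hlen ⟨0, T.pos⟩
    have h₃ := T.len_pos ⟨0, T.pos⟩
    rw [List.length_ofFn, List.flatMap_nil, List.length_nil] at h₁
    omega
  | cons i L =>
    rw [List.flatMap_cons] at hL
    have hi : x ∈ seqCylinder (T.node i) :=
      seqCylinder_anti (List.prefix_of_prefix_length_le (List.prefix_append _ _) hL
        (by rw [List.length_ofFn]; exact hlen i)) (mem_seqCylinder_ofFn x _)
    refine ⟨i, hi, fun n => ?_⟩
    have h := hx ((T.node i).length + n)
    have hsplit : (List.ofFn fun j : Fin ((T.node i).length + n) => x j) =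
        [i].flatMap T.node ++ List.ofFn fun j : Fin n => x ((T.node i).length + j) := by
      rw [List.ofFn_add]
      simpa using ofFn_eq_of_mem_seqCylinder hi
    rw [hsplit] at h
    exact mem_star_of_append_flatMap h

theorem exists_decode_eq {x : ℕ → Fin m} (hx : x ∈ T.fractal) : ∃ y, T.decode y = x := by
  choose f hf hf' using fun x : T.fractal => exists_node_of_mem_fractal x.2
  -- `tails n` is what remains of `x` after removing its first `n` terminal nodes
  let tails : ℕ → T.fractal → T.fractal := fun n => (fun x => ⟨_, hf' x⟩)^[n]
  refine ⟨fun n => f (tails n ⟨x, hx⟩), (eq_decode fun n => ?_).symm⟩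
  have key : ∀ (n : ℕ) (z : T.fractal),
      z.1 ∈ seqCylinder ((List.range n).flatMap fun i => T.node (f (tails i z))) := by
    intro n
    induction n with
    | zero => exact fun z i hi => by simp at hi
    | succ n ih =>
      intro z
      rw [T.flatMap_range_succ fun i => f (tails i z), mem_seqCylinder_append]
      exact ⟨hf z, ih ⟨_, hf' z⟩⟩
  exact key n ⟨x, hx⟩

theorem bijOn_decode : Set.BijOn T.decode Set.univ T.fractal :=
  ⟨fun y _ => T.decode_mem_fractal y, T.decode_injective.injOn, fun x hx => by
    obtain ⟨y, rfl⟩ := T.exists_decode_eq hx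
    exact ⟨y, Set.mem_univ _, rfl⟩⟩

/-! ### The Perron eigenvectors of the graph -/

/-- The exponential growth rate `2 ^ α` of the tree, where `α` is the channel capacity of its
length function. It turns out to be the Perron eigenvalue of the graph. -/
noncomputable def growth : ℝ := 2 ^ channelCapacity T.len

theorem growth_pos : 0 < T.growth := Real.rpow_pos_of_pos (by norm_num) _

theorem two_rpow_neg_channelCapacity_mul (n : ℕ) :
    (2 : ℝ) ^ (-channelCapacity T.len * (n : ℝ)) = (T.growth ^ n)⁻¹ := by
  rw [neg_mul, Real.rpow_neg (by norm_num), Real.rpow_mul (by norm_num), Real.rpow_natCast, growth]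

theorem sum_inv_growth_pow : ∑ i, (T.growth ^ T.len i)⁻¹ = 1 := by
  simpa only [two_rpow_neg_channelCapacity_mul] using
    (channelCapacity_spec T.len T.pos T.len_pos).2

open Classical in
/-- The weighted number of terminal nodes that extend the string `s`. On the vertices this is the
right Perron eigenvector with value `1` at the root. -/
noncomputable def weight (s : List (Fin m)) : ℝ :=
  ∑ i, if s <+: T.node i then T.growth ^ s.length * (T.growth ^ T.len i)⁻¹ else 0

theorem weight_nil : T.weight [] = 1 := by
  simp [weight, sum_inv_growth_pow]

theorem weight_node (i : Fin k) : T.weight (T.node i) = 1 := by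
  rw [weight, Finset.sum_eq_single i]
  · rw [if_pos List.prefix_rfl, len]
    exact mul_inv_cancel₀ (pow_ne_zero _ T.growth_pos.ne')
  · exact fun j _ hj => if_neg fun h => hj (T.prefix_free i j h).symm
  · simp

variable {T} in
theorem weight_pos {s : List (Fin m)} (hs : s ∈ T.nodes) : 0 < T.weight s := by
  have := T.growth_pos
  obtain ⟨i, hi⟩ := hs
  refine Finset.sum_pos' (fun j _ => ?_) ⟨i, Finset.mem_univ _, ?_⟩
  · split_ifs <;> positivity
  · rw [if_pos hi]
    positivity

variable {T} in
theorem weight_eq_zero {s : List (Fin m)} (hs : s ∉ T.nodes) : T.weight s = 0 :=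
  Finset.sum_eq_zero fun i _ => if_neg fun h => hs ⟨i, h⟩

variable {T} in
theorem weight_step {u : T.Vertex} {a : Fin m} (h : u.1 ++ [a] ∈ T.nodes) :
    T.weight (T.step u a).1 = T.weight (u.1 ++ [a]) := by
  by_cases h' : ∀ i, u.1 ++ [a] ≠ T.node i
  · rw [step_val ⟨h, h'⟩]
  · push Not at h'
    obtain ⟨i, hi⟩ := h'
    rw [step_eq_root hi, hi, weight_node]
    exact T.weight_nil

variable {T} in
theorem sum_weight_child (u : T.Vertex) :
    ∑ a, T.weight (u.1 ++ [a]) = T.growth * T.weight u.1 := by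
  simp only [weight]
  rw [Finset.sum_comm, Finset.mul_sum]
  refine Finset.sum_congr rfl fun i _ => ?_
  by_cases h : u.1 <+: T.node i
  · obtain ⟨t, ht⟩ := h
    -- the terminal node lies above exactly one child of `u`
    cases t with
    | nil => exact absurd (by simpa using ht) (u.2.2 i)
    | cons b t =>
      rw [if_pos ⟨_, ht⟩, Finset.sum_eq_single b]
      · rw [if_pos ⟨t, by simpa using ht⟩, List.length_append, List.length_singleton, pow_succ]
        ring
      · rintro a - hab
        refine if_neg ?_
        rw [← ht, List.prefix_append_right_inj, List.cons_prefix_cons]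
        exact fun h => hab h.1
      · simp
  · rw [if_neg h, mul_zero]
    exact Finset.sum_eq_zero fun a _ => if_neg fun h' => h ((List.prefix_append _ _).trans h')

open Classical in
theorem adjMatrix_apply (u v : T.Vertex) :
    T.graph.adjMatrix u v = ∑ a, if (u, a, v) ∈ T.graph.edges then 1 else 0 := by
  rw [PointedGraph.adjMatrix, Matrix.of_apply, Nat.card_eq_fintype_card, Fintype.card_subtype,
    Finset.sum_boole]

open Classical in
theorem adjMatrix_mulVec (r : T.Vertex → ℝ) (u : T.Vertex) :
    (T.graph.adjMatrix *ᵥ r) u = ∑ a, if u.1 ++ [a] ∈ T.nodes then r (T.step u a) else 0 := by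
  simp only [Matrix.mulVec, dotProduct, adjMatrix_apply, Finset.sum_mul]
  rw [Finset.sum_comm]
  refine Finset.sum_congr rfl fun a _ => ?_
  simp only [mem_graph_edges, ite_mul, one_mul, zero_mul, ite_and]
  split_ifs <;> simp

theorem adjMatrix_mulVec_weight :
    (T.graph.adjMatrix *ᵥ fun u => T.weight u.1) = T.growth • fun u => T.weight u.1 := by
  ext u
  rw [adjMatrix_mulVec, Pi.smul_apply, smul_eq_mul, ← sum_weight_child]
  refine Finset.sum_congr rfl fun a _ => ?_
  split_ifs with h
  · exact weight_step h
  · exact (weight_eq_zero h).symm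

variable {T} in
/-- Downward induction from the terminal nodes: the right eigenvector for the eigenvalue `growth` is
unique up to scaling. -/
theorem eq_weight_of_mulVec_eq {r : T.Vertex → ℝ} (hr : T.graph.adjMatrix *ᵥ r = T.growth • r)
    (u : T.Vertex) : r u = r T.root * T.weight u.1 := by
  have key : ∀ (d : ℕ) (u : T.Vertex), ∑ i, T.len i ≤ u.1.length + d →
      r u = r T.root * T.weight u.1 := by
    intro d
    induction d with
    | zero =>
      intro u hu
      obtain ⟨i, hi⟩ := u.2.1
      have h₁ : T.len i ≤ ∑ i, T.len i :=
        Finset.single_le_sum (f := T.len) (fun _ _ => Nat.zero_le _) (Finset.mem_univ i)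
      exact absurd (hi.eq_of_length_le (h₁.trans hu)) (u.2.2 i)
    | succ d ih =>
      intro u hu
      apply mul_left_cancel₀ T.growth_pos.ne'
      have h := congrFun hr u
      rw [adjMatrix_mulVec, Pi.smul_apply, smul_eq_mul] at h
      rw [← h, mul_left_comm, ← sum_weight_child, Finset.mul_sum]
      refine Finset.sum_congr rfl fun a _ => ?_
      split_ifs with h
      · rw [← weight_step h]
        by_cases h' : ∀ i, u.1 ++ [a] ≠ T.node i
        · apply ih
          rw [step_val ⟨h, h'⟩, List.length_append, List.length_singleton]
          omega
        · push Not at h'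
          obtain ⟨i, hi⟩ := h'
          rw [step_eq_root hi, show T.root.1 = [] from rfl, weight_nil, mul_one]
      · rw [weight_eq_zero h, mul_zero]
  exact key _ u (Nat.le_add_left _ _)

open Classical in
theorem sum_ite_append_singleton_eq (f : T.Vertex → ℝ) (p : T.Vertex) (b : Fin m) :
    (∑ u, ∑ a, if u.1 ++ [a] = p.1 ++ [b] then f u else 0) = f p := by
  rw [Finset.sum_eq_single p, Finset.sum_eq_single b]
  · simp
  · intro a _ hab
    simp [hab]
  · simp
  · intro u _ hu
    refine Finset.sum_eq_zero fun a _ => if_neg fun h => hu (Subtype.ext ?_)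
    exact (List.append_inj' h rfl).1
  · simp

theorem vecMul_adjMatrix_child (l : T.Vertex → ℝ) {v p : T.Vertex} {b : Fin m}
    (h : p.1 ++ [b] = v.1) : (l ᵥ* T.graph.adjMatrix) v = l p := by
  classical
  simp only [Matrix.vecMul, dotProduct, adjMatrix_apply, Finset.mul_sum, mul_ite, mul_one, mul_zero]
  rw [← T.sum_ite_append_singleton_eq l p b]
  refine Finset.sum_congr rfl fun u _ => Finset.sum_congr rfl fun a _ => ?_
  have hv : v ≠ T.root := by
    rintro rfl
    simp [root] at h
  have : (u, a, v) ∈ T.graph.edges ↔ u.1 ++ [a] = p.1 ++ [b] := by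
    rw [h]
    simp [graph, hv]
  simp only [this]

/-- The left eigenvector equation at the root, where the edges that replace the edges to the
terminal nodes come in. -/
theorem vecMul_adjMatrix_root :
    ((fun u : T.Vertex => (T.growth ^ u.1.length)⁻¹) ᵥ* T.graph.adjMatrix) T.root = T.growth := by
  classical
  simp only [Matrix.vecMul, dotProduct, adjMatrix_apply, Finset.mul_sum, mul_ite, mul_one, mul_zero]
  have hedge : ∀ (u : T.Vertex) (a : Fin m),
      (if (u, a, T.root) ∈ T.graph.edges then (T.growth ^ u.1.length)⁻¹ else 0) =
        ∑ i, if u.1 ++ [a] = T.node i then (T.growth ^ u.1.length)⁻¹ else 0 := by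
    intro u a
    have hiff : (u, a, T.root) ∈ T.graph.edges ↔ ∃ i, u.1 ++ [a] = T.node i :=
      ⟨fun h => h.elim (fun h => absurd h (by simp [root])) And.right, fun h => Or.inr ⟨rfl, h⟩⟩
    by_cases h : ∃ i, u.1 ++ [a] = T.node i
    · rw [if_pos (hiff.2 h)]
      obtain ⟨i, hi⟩ := h
      rw [Finset.sum_eq_single i, if_pos hi]
      · exact fun j _ hj => if_neg fun h => hj (T.node_injective (h.symm.trans hi))
      · simp
    · rw [if_neg (fun h' => h (hiff.1 h'))]
      exact (Finset.sum_eq_zero fun i _ => if_neg fun h' => h ⟨i, h'⟩).symm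
  simp only [hedge]
  have hswap : (∑ u : T.Vertex, ∑ a, ∑ i,
      if u.1 ++ [a] = T.node i then (T.growth ^ u.1.length)⁻¹ else 0) =
      ∑ i, T.growth * (T.growth ^ T.len i)⁻¹ := by
    rw [Finset.sum_congr rfl fun u _ => Finset.sum_comm, Finset.sum_comm]
    refine Finset.sum_congr rfl fun i _ => ?_
    obtain ⟨p, b, h⟩ := exists_parent (T.node_mem_nodes i) (T.node_ne_nil i)
    have := T.growth_pos.ne'
    rw [len, ← h, T.sum_ite_append_singleton_eq (fun u => (T.growth ^ u.1.length)⁻¹),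
      List.length_append, List.length_singleton, pow_succ]
    field_simp
  rw [hswap, ← Finset.mul_sum, sum_inv_growth_pow, mul_one]

theorem vecMul_adjMatrix_inv_growth_pow :
    (fun u : T.Vertex => (T.growth ^ u.1.length)⁻¹) ᵥ* T.graph.adjMatrix =
      T.growth • fun u : T.Vertex => (T.growth ^ u.1.length)⁻¹ := by
  ext v
  rw [Pi.smul_apply, smul_eq_mul]
  by_cases hv : v.1 = []
  · obtain rfl : v = T.root := Subtype.ext hv
    rw [vecMul_adjMatrix_root]
    simp [root]
  · obtain ⟨p, b, h⟩ := exists_parent v.2.1 hv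
    have := T.growth_pos.ne'
    rw [T.vecMul_adjMatrix_child _ h, ← h, List.length_append, List.length_singleton, pow_succ]
    field_simp

variable {T} in
/-- Upward induction from the root: the left eigenvector for the eigenvalue `growth` is unique up to
scaling. -/
theorem eq_of_vecMul_eq {l : T.Vertex → ℝ} (hl : l ᵥ* T.graph.adjMatrix = T.growth • l)
    (u : T.Vertex) : l u = l T.root * (T.growth ^ u.1.length)⁻¹ := by
  have key : ∀ (n : ℕ) (u : T.Vertex), u.1.length = n →
      l u = l T.root * (T.growth ^ u.1.length)⁻¹ := by
    intro n
    induction n with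
    | zero =>
      intro u hu
      obtain rfl : u = T.root := Subtype.ext (List.length_eq_zero_iff.1 hu)
      simp [root]
    | succ n ih =>
      intro u hu
      obtain ⟨p, b, h⟩ := exists_parent u.2.1 fun h => by simp [h] at hu
      have hp := congrFun hl u
      rw [T.vecMul_adjMatrix_child _ h, Pi.smul_apply, smul_eq_mul] at hp
      have hlen : u.1.length = p.1.length + 1 := by rw [← h]; simp
      apply mul_left_cancel₀ T.growth_pos.ne'
      have := T.growth_pos.ne'
      rw [← hp, ih p (by omega), hlen, pow_succ]
      field_simp
  exact key _ u rfl

end FiniteTree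

/-- A nonnegative matrix with a positive left eigenvector for `c` has no real eigenvalue above
`c`. -/
theorem Matrix.eigenvalue_le_of_vecMul_eq_smul {V : Type*} [Fintype V] {A : Matrix V V ℝ}
    (hA : ∀ u v, 0 ≤ A u v) {l : V → ℝ} (hl : ∀ v, 0 < l v) {c : ℝ} (hlA : l ᵥ* A = c • l)
    {x : ℝ} {f : V → ℝ} (hf : f ≠ 0) (hAf : A *ᵥ f = x • f) : x ≤ c := by
  have hpos : 0 < l ⬝ᵥ fun v => |f v| := by
    obtain ⟨v, hv⟩ := Function.ne_iff.1 hf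
    exact Finset.sum_pos' (fun u _ => mul_nonneg (hl u).le (abs_nonneg _))
      ⟨v, Finset.mem_univ _, mul_pos (hl v) (abs_pos.2 hv)⟩
  refine le_of_mul_le_mul_right ?_ hpos
  calc x * (l ⬝ᵥ fun v => |f v|) ≤ l ⬝ᵥ (A *ᵥ fun v => |f v|) := by
        rw [dotProduct, Finset.mul_sum]
        refine Finset.sum_le_sum fun v _ => ?_
        rw [mul_left_comm]
        refine mul_le_mul_of_nonneg_left ?_ (hl v).le
        calc x * |f v| ≤ |x| * |f v| := mul_le_mul_of_nonneg_right (le_abs_self x) (abs_nonneg _)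
          _ = |(A *ᵥ f) v| := by rw [hAf, Pi.smul_apply, smul_eq_mul, abs_mul]
          _ ≤ ∑ u, |A v u * f u| := Finset.abs_sum_le_sum_abs _ _
          _ = (A *ᵥ fun v => |f v|) v :=
            Finset.sum_congr rfl fun u _ => by rw [abs_mul, abs_of_nonneg (hA v u)]
    _ = c * (l ⬝ᵥ fun v => |f v|) := by
        rw [Matrix.dotProduct_mulVec, hlA, smul_dotProduct, smul_eq_mul]

namespace FiniteTree

variable {m k : ℕ} (T : FiniteTree m k)

theorem perronEigenvalue_graph : T.graph.perronEigenvalue = T.growth := by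
  refine IsGreatest.csSup_eq ⟨?_, fun x hx => ?_⟩
  · rw [Set.mem_ofPred_eq]
    refine Module.End.hasEigenvalue_of_hasEigenvector (x := fun u => T.weight u.1)
      ⟨Module.End.mem_eigenspace_iff.2 T.adjMatrix_mulVec_weight, fun h => ?_⟩
    exact (weight_pos T.root.2.1).ne' (congrFun h T.root)
  · obtain ⟨f, hf⟩ := Module.End.HasEigenvalue.exists_hasEigenvector hx
    refine Matrix.eigenvalue_le_of_vecMul_eq_smul (fun u v => ?_) (fun v => ?_)
      T.vecMul_adjMatrix_inv_growth_pow hf.2 hf.apply_eq_smul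
    · exact Nat.cast_nonneg _
    · exact inv_pos.2 (pow_pos T.growth_pos _)

end FiniteTree

namespace PointedGraph

variable {m : ℕ} {V : Type} (G : PointedGraph m V)

/-! ### Measures on the space of walks -/

variable {G} in
/-- The set of walks that agree with `w` on the edges `0, …, n`. -/
def walkCylinder (w : G.Walk) (n : ℕ) : Set G.Walk := {w' | ∀ i ≤ n, w'.1 i = w.1 i}

variable {G} in
theorem measurable_walk_edge (n : ℕ) : Measurable fun w : G.Walk => w.1 n :=
  (measurable_pi_apply n).comp measurable_subtype_coe

variable {G} in
theorem measurable_labels : Measurable (Walk.labels (G := G)) :=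
  measurable_pi_lambda _ fun n => Measurable.comp (measurable_from_top) (measurable_walk_edge n)

variable {G} in
theorem measurableSet_walkCylinder (w : G.Walk) (n : ℕ) : MeasurableSet (walkCylinder w n) := by
  rw [walkCylinder, Set.ofPred_forall]
  refine MeasurableSet.iInter fun i => ?_
  rw [Set.ofPred_forall]
  exact MeasurableSet.iInter fun _ =>
    measurable_walk_edge i (MeasurableSpace.measurableSet_top (s := {w.1 i}))

theorem measurableSet_pointedWalks : MeasurableSet G.pointedWalks :=
  measurableSet_preimage (measurable_walk_edge 0)
    (MeasurableSpace.measurableSet_top (s := {e : G.Edge | e.src = G.pt}))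

theorem generateFrom_walkCylinder [Finite G.Edge] :
    (inferInstance : MeasurableSpace G.Walk) =
      MeasurableSpace.generateFrom {s | ∃ w n, s = walkCylinder (G := G) w n} := by
  apply le_antisymm
  · have hle : ∀ n (S : Set G.Edge), MeasurableSet[MeasurableSpace.generateFrom
        {s | ∃ w n, s = walkCylinder (G := G) w n}] {w : G.Walk | w.1 n ∈ S} := by
      intro n S
      have hfin : (Set.range fun w : G.Walk => walkCylinder w n).Finite := by
        refine (Set.finite_range fun f : Fin (n + 1) → G.Edge =>
          {w : G.Walk | ∀ i : Fin (n + 1), w.1 i = f i}).subset ?_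
        rintro _ ⟨w, rfl⟩
        refine ⟨fun i => w.1 i, ?_⟩
        ext w'
        exact ⟨fun h i hi => h ⟨i, by omega⟩, fun h i => h i (by omega)⟩
      have hunion : {w : G.Walk | w.1 n ∈ S} =
          ⋃₀ {s ∈ Set.range fun w : G.Walk => walkCylinder w n | s ⊆ {w | w.1 n ∈ S}} := by
        refine Set.Subset.antisymm (fun w hw => ?_) (Set.sUnion_subset fun s hs => hs.2)
        refine ⟨_, ⟨⟨w, rfl⟩, fun w' hw' => ?_⟩, fun i _ => rfl⟩
        rw [Set.mem_ofPred_eq, hw' n le_rfl]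
        exact hw
      rw [hunion]
      refine MeasurableSet.sUnion (hfin.subset (Set.sep_subset _ _)).countable ?_
      rintro _ ⟨⟨w, rfl⟩, -⟩
      exact MeasurableSpace.measurableSet_generateFrom ⟨w, n, rfl⟩
    exact measurable_iff_comap_le.1
      (@measurable_pi_lambda _ _ _ (_) _ _ fun n S _ => hle n S)
  · refine MeasurableSpace.generateFrom_le ?_
    rintro _ ⟨w, n, rfl⟩
    exact measurableSet_walkCylinder w n

variable {G} in
/-- A probability measure on the walks is determined by the cylinders of walks. -/
theorem ext_of_walkCylinder [Finite G.Edge] {P Q : Measure G.Walk} [IsProbabilityMeasure P]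
    [IsProbabilityMeasure Q] (h : ∀ w n, P (walkCylinder w n) = Q (walkCylinder w n)) :
    P = Q := by
  refine ext_of_generate_finite _ G.generateFrom_walkCylinder ?_ ?_ (by simp)
  · -- of two cylinders that intersect, the longer one is contained in the other
    rintro _ ⟨w, n, rfl⟩ _ ⟨w', n', rfl⟩ ⟨z, hz, hz'⟩
    refine ⟨z, max n n', ?_⟩
    ext x
    constructor
    · rintro ⟨hx, hx'⟩ i hi
      rcases le_max_iff.1 hi with hi | hi
      · rw [hx i hi, hz i hi]
      · rw [hx' i hi, hz' i hi]
    · intro hx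
      exact ⟨fun i hi => (hx i (le_max_of_le_left hi)).trans (hz i hi),
        fun i hi => (hx i (le_max_of_le_right hi)).trans (hz' i hi)⟩
  · rintro _ ⟨w, n, rfl⟩
    exact h w n

variable {G} in
/-- The walk that is left after removing the first `d` edges. -/
def Walk.drop (d : ℕ) (w : G.Walk) : G.Walk := ⟨fun n => w.1 (d + n), fun n => w.2 (d + n)⟩

variable {G} in
theorem measurable_drop (d : ℕ) : Measurable (Walk.drop (G := G) d) :=
  Measurable.subtype_mk (measurable_pi_lambda _ fun n => measurable_walk_edge (d + n))

end PointedGraph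

/-- A function of a sequence over a finite alphabet that depends on finitely many terms only is
measurable. -/
theorem measurable_of_depends_on_initial {k : ℕ} {β : Type*} [MeasurableSpace β]
    {f : (ℕ → Fin k) → β} (n : ℕ) (h : ∀ y y', (∀ i ≤ n, y i = y' i) → f y = f y') :
    Measurable f := by
  have hf : f = (fun z : Fin (n + 1) → Fin k =>
      f fun j => z ⟨min j n, Nat.lt_succ_of_le (min_le_right j n)⟩) ∘ fun y i => y i := by
    ext y
    refine h _ _ fun i hi => ?_
    simp [hi]
  rw [hf]
  exact Measurable.of_discrete.comp (measurable_pi_lambda _ fun i => measurable_pi_apply _)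

theorem measurableSet_seqCylinder {m : ℕ} (s : List (Fin m)) : MeasurableSet (seqCylinder s) := by
  rw [seqCylinder, Set.ofPred_forall]
  refine MeasurableSet.iInter fun i => ?_
  rw [Set.ofPred_forall]
  exact MeasurableSet.iInter fun _ => measurable_pi_apply i (measurableSet_singleton _)

namespace FiniteTree

variable {m k : ℕ} (T : FiniteTree m k)

/-! ### The Bernoulli measure and decoding -/

instance : IsProbabilityMeasure T.bernoulli := by
  unfold bernoulli
  infer_instance

theorem symbolMeasure_singleton (i : Fin k) :
    symbolMeasure T.len {i} = ENNReal.ofReal (T.growth ^ T.len i)⁻¹ := by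
  simp only [symbolMeasure, Measure.coe_finsetSum, Finset.sum_apply, Measure.smul_apply,
    smul_eq_mul]
  rw [Finset.sum_eq_single i]
  · rw [two_rpow_neg_channelCapacity_mul]
    simp
  · intro j _ hj
    simp [hj]
  · simp

theorem bernoulli_seqCylinder (L : List (Fin k)) :
    T.bernoulli (seqCylinder L) = ENNReal.ofReal (T.growth ^ (L.flatMap T.node).length)⁻¹ := by
  have hpi : seqCylinder L = Set.pi (Finset.range L.length : Finset ℕ)
      fun n => if h : n < L.length then {L[n]} else Set.univ := by
    ext y
    simp only [seqCylinder, Set.mem_ofPred_eq, Set.mem_pi, Finset.coe_range, Set.mem_Iio]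
    refine forall_congr' fun n => forall_congr' fun h => ?_
    rw [dif_pos h, Set.mem_singleton_iff]
  rw [hpi, bernoulli, Measure.infinitePi_pi _ fun _ _ => .of_discrete, Finset.prod_range]
  simp only [Fin.is_lt, dite_true, symbolMeasure_singleton]
  rw [Fin.prod_univ_fun_getElem L fun i => ENNReal.ofReal (T.growth ^ T.len i)⁻¹]
  clear hpi
  induction L with
  | nil => simp
  | cons i L ih =>
    have := T.growth_pos
    rw [List.map_cons, List.prod_cons, ih, ← ENNReal.ofReal_mul (by positivity),
      List.flatMap_cons, List.length_append, pow_add, mul_inv, len]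

theorem bernoulli_decode_mem_seqCylinder (L : List (Fin k)) (u : T.Vertex) :
    T.bernoulli {y | T.decode y ∈ seqCylinder (L.flatMap T.node ++ u.1)} =
      ENNReal.ofReal ((T.growth ^ (L.flatMap T.node ++ u.1).length)⁻¹ * T.weight u.1) := by
  classical
  have hg := T.growth_pos
  have hunion : {y | T.decode y ∈ seqCylinder (L.flatMap T.node ++ u.1)} =
      ⋃ i ∈ Finset.univ.filter fun i => u.1 <+: T.node i, seqCylinder (L ++ [i]) := by
    ext y
    simp [decode_mem_seqCylinder_flatMap_append]
  have hterm : ∀ i, T.bernoulli (seqCylinder (L ++ [i])) =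
      ENNReal.ofReal ((T.growth ^ (L.flatMap T.node ++ u.1).length)⁻¹ *
        (T.growth ^ u.1.length * (T.growth ^ T.len i)⁻¹)) := by
    intro i
    rw [bernoulli_seqCylinder]
    congr 1
    simp only [List.flatMap_append, List.flatMap_singleton, List.length_append, pow_add, len]
    field_simp
  rw [hunion, measure_biUnion_finset]
  · simp only [hterm]
    rw [← ENNReal.ofReal_sum_of_nonneg fun i _ => by positivity, ← Finset.mul_sum, weight,
      Finset.sum_filter]
  · intro i _ j _ hij
    refine Set.disjoint_left.2 fun y hi hj => hij ?_
    have hi' := (mem_seqCylinder_append.1 hi).2 0 (by simp)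
    have hj' := (mem_seqCylinder_append.1 hj).2 0 (by simp)
    exact hi'.symm.trans hj'
  · exact fun i _ => measurableSet_seqCylinder _

theorem decode_congr {y y' : ℕ → Fin k} {n : ℕ} (h : ∀ i ≤ n, y i = y' i) :
    T.decode y n = T.decode y' n := by
  have : ((List.range (n + 1)).flatMap fun i => T.node (y i)) =
      (List.range (n + 1)).flatMap fun i => T.node (y' i) :=
    List.flatMap_congr fun i hi => by rw [h i (by simpa [Nat.lt_succ_iff] using hi)]
  simp only [decode, this]

theorem measurable_decode : Measurable T.decode :=
  measurable_pi_lambda _ fun n => measurable_of_depends_on_initial n fun _ _ h => T.decode_congr h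

/-! ### The Parry measure -/

/-- The walk from the root that is labelled by the concatenation of the terminal nodes with the
indices `y 0, y 1, …`. -/
noncomputable def codedWalk (y : ℕ → Fin k) : T.graph.Walk :=
  T.walkOf (T.decode y) (T.decode_mem_fractal y)

theorem codedWalk_src_zero (y : ℕ → Fin k) : ((T.codedWalk y).1 0).src = T.root := rfl

theorem measurable_codedWalk : Measurable T.codedWalk :=
  Measurable.subtype_mk <| measurable_pi_lambda _ fun n =>
    measurable_of_depends_on_initial n fun y y' h =>
      T.walk_eq_of_labels_eq (w := T.codedWalk y) (w' := T.codedWalk y') rfl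
        (fun _ hi => T.decode_congr fun j hj => h j (hj.trans hi)) n le_rfl

/-- The codes of the sequences that start with the vertex `u`. -/
def codesAbove (u : T.Vertex) : Set (ℕ → Fin k) := {y | u.1 <+: T.node (y 0)}

variable {T} in
theorem drop_codedWalk_src {u : T.Vertex} {y : ℕ → Fin k} (hy : y ∈ T.codesAbove u) :
    (((T.codedWalk y).drop u.1.length).1 0).src = u :=
  T.walk_src_eq_of_labels_mem (T.codedWalk_src_zero y) u (decode_mem_seqCylinder_vertex.2 hy)

theorem codesAbove_root : T.codesAbove T.root = Set.univ :=
  Set.eq_univ_of_forall fun _ => List.nil_prefix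

/-- The normalizing constant for the eigenvectors: the scalar product of the left eigenvector
`u ↦ growth ^ (-|u|)` and the right eigenvector `weight`. -/
noncomputable def parryNorm : ℝ := ∑ u : T.Vertex, (T.growth ^ u.1.length)⁻¹ * T.weight u.1

theorem parryNorm_pos : 0 < T.parryNorm :=
  Finset.sum_pos (fun u _ => mul_pos (inv_pos.2 (pow_pos T.growth_pos _)) (weight_pos u.2.1))
    ⟨T.root, Finset.mem_univ _⟩

/-- The Parry measure on the walks: the stationary tower over the Bernoulli measure. A level of the
tower is a vertex `u`. It is reached, when the first terminal node lies above `u`, after `|u|` steps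
of the coded walk, and it contributes the law of the rest of that walk. -/
noncomputable def parry : Measure T.graph.Walk :=
  ∑ u : T.Vertex, ENNReal.ofReal T.parryNorm⁻¹ •
    (T.bernoulli.restrict (T.codesAbove u)).map fun y => (T.codedWalk y).drop u.1.length

theorem parry_apply {S : Set T.graph.Walk} (hS : MeasurableSet S) :
    T.parry S = ∑ u : T.Vertex, ENNReal.ofReal T.parryNorm⁻¹ *
      T.bernoulli {y | y ∈ T.codesAbove u ∧ (T.codedWalk y).drop u.1.length ∈ S} := by
  simp only [parry, Measure.coe_finsetSum, Finset.sum_apply, Measure.smul_apply, smul_eq_mul]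
  refine Finset.sum_congr rfl fun u _ => ?_
  have hm : Measurable fun y => (T.codedWalk y).drop u.1.length :=
    (PointedGraph.measurable_drop _).comp T.measurable_codedWalk
  rw [Measure.map_apply hm hS, Measure.restrict_apply (hm hS), Set.inter_comm]
  rfl

/-- On walks from a fixed vertex only one level of the tower contributes. -/
theorem parry_apply_of_src {S : Set T.graph.Walk} (hS : MeasurableSet S) (u : T.Vertex)
    (hu : ∀ w ∈ S, (w.1 0).src = u) :
    T.parry S = ENNReal.ofReal T.parryNorm⁻¹ *
      T.bernoulli {y | y ∈ T.codesAbove u ∧ (T.codedWalk y).drop u.1.length ∈ S} := by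
  rw [T.parry_apply hS]
  refine Finset.sum_eq_single_of_mem u (Finset.mem_univ u) fun v _ hv => ?_
  have : {y | y ∈ T.codesAbove v ∧ (T.codedWalk y).drop v.1.length ∈ S} = ∅ :=
    Set.eq_empty_of_forall_notMem fun y hy =>
      hv ((drop_codedWalk_src hy.1).symm.trans (hu _ hy.2))
  rw [this, measure_empty, mul_zero]

instance : IsProbabilityMeasure T.parry := by
  constructor
  have hterm : ∀ u : T.Vertex, T.bernoulli (T.codesAbove u) =
      ENNReal.ofReal ((T.growth ^ u.1.length)⁻¹ * T.weight u.1) := by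
    intro u
    have h := T.bernoulli_decode_mem_seqCylinder [] u
    simp only [List.flatMap_nil, List.nil_append, decode_mem_seqCylinder_vertex] at h
    exact h
  have := T.growth_pos
  rw [T.parry_apply MeasurableSet.univ]
  simp only [Set.mem_univ, and_true, Set.ofPred_mem_eq, hterm]
  rw [← Finset.mul_sum, ← ENNReal.ofReal_sum_of_nonneg fun u _ =>
    mul_nonneg (by positivity) (weight_pos u.2.1).le,
    ← ENNReal.ofReal_mul (inv_nonneg.2 T.parryNorm_pos.le)]
  change ENNReal.ofReal (T.parryNorm⁻¹ * T.parryNorm) = 1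
  rw [inv_mul_cancel₀ T.parryNorm_pos.ne', ENNReal.ofReal_one]

/-- The coded walks that pass through `w` at the level of its initial vertex are those whose labels
start with this vertex and the labels of `w`. -/
theorem mem_codesAbove_and_drop_mem_walkCylinder (w : T.graph.Walk) (n : ℕ) (y : ℕ → Fin k) :
    (y ∈ T.codesAbove (w.1 0).src ∧
      (T.codedWalk y).drop (w.1 0).src.1.length ∈ PointedGraph.walkCylinder w n) ↔
    T.decode y ∈
      seqCylinder ((w.1 0).src.1 ++ List.ofFn fun i : Fin (n + 1) => w.labels i) := by
  rw [mem_seqCylinder_append, decode_mem_seqCylinder_vertex]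
  refine and_congr_right fun hy => ⟨fun h i hi => ?_, fun h => ?_⟩
  · rw [List.length_ofFn] at hi
    rw [List.getElem_ofFn]
    exact congrArg PointedGraph.Edge.label (h i (by omega))
  · refine T.walk_eq_of_labels_eq (drop_codedWalk_src hy) fun i hi => ?_
    have := h i (by rw [List.length_ofFn]; omega)
    rw [List.getElem_ofFn] at this
    exact this

theorem parry_walkCylinder (w : T.graph.Walk) (n : ℕ) :
    T.parry (PointedGraph.walkCylinder w n) = ENNReal.ofReal (T.parryNorm⁻¹ *
      ((T.growth ^ ((w.1 0).src.1.length + (n + 1)))⁻¹ * T.weight (w.1 n).tgt.1)) := by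
  rw [T.parry_apply_of_src (PointedGraph.measurableSet_walkCylinder w n) (w.1 0).src
    fun w' hw' => by rw [hw' 0 (Nat.zero_le n)]]
  simp only [mem_codesAbove_and_drop_mem_walkCylinder]
  obtain ⟨L, hL⟩ := T.exists_src_append_labels w (n + 1)
  have hlen : (L.flatMap T.node ++ (w.1 (n + 1)).src.1).length =
      (w.1 0).src.1.length + (n + 1) := by
    rw [← hL, List.length_append, List.length_ofFn]
  rw [hL, bernoulli_decode_mem_seqCylinder, ← ENNReal.ofReal_mul (inv_nonneg.2 T.parryNorm_pos.le),
    hlen, w.2 n]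

/-- The product of the transition probabilities along a walk telescopes. -/
theorem prod_transition (r : T.Vertex → ℝ) (hr : ∀ v, 0 < r v) (w : T.graph.Walk) (n : ℕ) :
    r (w.1 0).src * ∏ i ∈ Finset.range (n + 1),
      r (w.1 i).tgt / (r (w.1 i).src * T.growth) =
      (T.growth ^ (n + 1))⁻¹ * r (w.1 n).tgt := by
  have hg := T.growth_pos.ne'
  induction n with
  | zero =>
    have := (hr (w.1 0).src).ne'
    simp
    field_simp
  | succ n ih =>
    have := (hr (w.1 (n + 1)).src).ne'
    rw [Finset.prod_range_succ, ← mul_assoc, ih, w.2 n, pow_succ _ (n + 1)]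
    field_simp

theorem isParryMeasure_parry : T.graph.IsParryMeasure T.parry := by
  have hg := T.growth_pos
  have hZ := T.parryNorm_pos
  refine ⟨inferInstance, fun u => T.parryNorm⁻¹ * (T.growth ^ u.1.length)⁻¹,
    fun u => T.weight u.1, fun u => by positivity, fun u => weight_pos u.2.1, ?_, ?_, ?_,
    fun w n => ?_⟩
  · rw [perronEigenvalue_graph]
    have h := T.vecMul_adjMatrix_inv_growth_pow
    change (T.parryNorm⁻¹ • fun u : T.Vertex => (T.growth ^ u.1.length)⁻¹) ᵥ* _ =
      T.growth • (T.parryNorm⁻¹ • fun u : T.Vertex => (T.growth ^ u.1.length)⁻¹)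
    rw [Matrix.smul_vecMul, h, smul_comm]
  · rw [perronEigenvalue_graph]
    exact T.adjMatrix_mulVec_weight
  · simp only [mul_assoc]
    rw [← Finset.mul_sum]
    exact inv_mul_cancel₀ hZ.ne'
  · refine (T.parry_walkCylinder w n).trans ?_
    rw [mul_assoc _ (T.weight _), perronEigenvalue_graph,
      T.prod_transition (fun u => T.weight u.1) (fun u => weight_pos u.2.1), pow_add, mul_inv]
    ring_nf

variable {T} in
theorem eq_parry {P : Measure T.graph.Walk} (hP : T.graph.IsParryMeasure P) : P = T.parry := by
  obtain ⟨hprob, l, r, hl, hr, hlA, hrA, hlr, hcyl⟩ := hP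
  rw [perronEigenvalue_graph] at hlA hrA hcyl
  have hl' := eq_of_vecMul_eq hlA
  have hr' := eq_weight_of_mulVec_eq hrA
  -- the two scaling factors are tied by the normalization of the eigenvectors
  have hnorm : l T.root * r T.root = T.parryNorm⁻¹ := by
    refine eq_inv_of_mul_eq_one_left ?_
    rw [← hlr, parryNorm, Finset.mul_sum]
    refine Finset.sum_congr rfl fun u _ => ?_
    rw [hl' u, hr' u]
    ring
  refine PointedGraph.ext_of_walkCylinder fun w n => ?_
  rw [parry_walkCylinder]
  refine (hcyl w n).trans ?_
  rw [mul_assoc, T.prod_transition r hr, hl', hr' (w.1 n).tgt, ← hnorm, pow_add, mul_inv]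
  ring_nf

/-! ### The restriction to the path set -/

theorem map_labels_soficShift : T.parry.map PointedGraph.Walk.labels T.graph.soficShift = 1 := by
  have := Measure.isProbabilityMeasure_map (μ := T.parry)
    (PointedGraph.measurable_labels (G := T.graph)).aemeasurable
  refine le_antisymm prob_le_one ?_
  refine le_trans ?_ (Measure.le_map_apply PointedGraph.measurable_labels.aemeasurable _)
  rw [PointedGraph.soficShift, Set.preimage_range, measure_univ]

/-- Conditioning on the bottom level of the tower gives back the law of the coded walk. -/
theorem cond_parry_pointedWalks :
    T.parry[|T.graph.pointedWalks] = T.bernoulli.map T.codedWalk := by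
  have key : ∀ S, MeasurableSet S → T.parry (T.graph.pointedWalks ∩ S) =
      ENNReal.ofReal T.parryNorm⁻¹ * T.bernoulli (T.codedWalk ⁻¹' S) := by
    intro S hS
    rw [T.parry_apply_of_src (T.graph.measurableSet_pointedWalks.inter hS) T.root fun w hw => hw.1,
      codesAbove_root]
    congr 2
    ext y
    have h0 : (T.codedWalk y).drop T.root.1.length = T.codedWalk y :=
      Subtype.ext (funext fun n => congrArg (T.codedWalk y).1 (Nat.zero_add n))
    rw [Set.mem_ofPred_eq, h0]
    exact ⟨fun h => h.2.2, fun h => ⟨Set.mem_univ _, T.codedWalk_src_zero y, h⟩⟩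
  have hpos : ENNReal.ofReal T.parryNorm⁻¹ ≠ 0 :=
    (ENNReal.ofReal_pos.2 (inv_pos.2 T.parryNorm_pos)).ne'
  have h1 : T.parry T.graph.pointedWalks = ENNReal.ofReal T.parryNorm⁻¹ := by
    simpa using key Set.univ MeasurableSet.univ
  ext S hS
  rw [cond_apply T.graph.measurableSet_pointedWalks, key S hS, h1,
    Measure.map_apply T.measurable_codedWalk hS, ← mul_assoc,
    ENNReal.inv_mul_cancel hpos ENNReal.ofReal_ne_top, one_mul]

theorem restrictToPathSet_parry :
    T.graph.restrictToPathSet T.parry = T.bernoulli.map T.decode := by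
  rw [PointedGraph.restrictToPathSet, cond_parry_pointedWalks,
    Measure.map_map PointedGraph.measurable_labels T.measurable_codedWalk]
  rfl

theorem map_decode_fractal : T.bernoulli.map T.decode T.fractal = 1 := by
  have := Measure.isProbabilityMeasure_map (μ := T.bernoulli) T.measurable_decode.aemeasurable
  refine le_antisymm prob_le_one ?_
  refine le_trans ?_ (Measure.le_map_apply T.measurable_decode.aemeasurable _)
  rw [Set.eq_univ_of_forall (s := T.decode ⁻¹' T.fractal) T.decode_mem_fractal, measure_univ]

theorem map_decode_seqCylinder_node (i : Fin k) :
    T.bernoulli.map T.decode (seqCylinder (T.node i)) =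
      ENNReal.ofReal (T.growth ^ (T.node i).length)⁻¹ := by
  rw [Measure.map_apply T.measurable_decode (measurableSet_seqCylinder _)]
  have h := T.bernoulli_decode_mem_seqCylinder [i] T.root
  rw [show T.root.1 = [] from rfl, List.append_nil, List.flatMap_singleton, weight_nil,
    mul_one] at h
  exact h

end FiniteTree

theorem mainTheorem6 {m k : ℕ} (T : FiniteTree m k) :
    T.graph.pathSet = T.fractal ∧
    Set.BijOn T.decode Set.univ T.fractal ∧
    (∃! P : Measure T.graph.Walk, T.graph.IsParryMeasure P) ∧
    ∀ P : Measure T.graph.Walk, T.graph.IsParryMeasure P →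
      P.map PointedGraph.Walk.labels T.graph.soficShift = 1 ∧
      T.graph.restrictToPathSet P T.graph.pathSet = 1 ∧
      T.graph.restrictToPathSet P = T.bernoulli.map T.decode ∧
      ∀ i : Fin k,
        T.graph.restrictToPathSet P (seqCylinder (T.node i)) =
          ENNReal.ofReal ((T.graph.perronEigenvalue ^ (T.node i).length)⁻¹) ∧
        T.bernoulli.map T.decode (seqCylinder (T.node i)) =
          ENNReal.ofReal ((T.graph.perronEigenvalue ^ (T.node i).length)⁻¹) := by
  refine ⟨T.pathSet_graph, T.bijOn_decode,
    ⟨T.parry, T.isParryMeasure_parry, fun P hP => FiniteTree.eq_parry hP⟩, fun P hP => ?_⟩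
  obtain rfl := FiniteTree.eq_parry hP
  rw [T.restrictToPathSet_parry, T.pathSet_graph, T.perronEigenvalue_graph]
  exact ⟨T.map_labels_soficShift, T.map_decode_fractal, rfl,
    fun i => ⟨T.map_decode_seqCylinder_node i, T.map_decode_seqCylinder_node i⟩⟩
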